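/- Let $\mathbb{C}_+=\{w\in\mathbb{C}:\operatorname{Re} w>0\}$ and let $H^2(\mathbb{C}_+)$ be the Hilbert space of holomorphic functions $f$ on $\mathbb{C}_+$ with $$\|f\|=\Bigl(\sup_{x>0}\frac1\pi\int_{-\infty}^{\infty}|f(x+iy)|^2\,dy\Bigr)^{1/2}<\infty .$$ For a self-map $\phi$ of $\mathbb{C}_+$ write $C_\phi f=f\circ\phi$. A conjugation on a complex Hilbert space $\mathcal H$ is a conjugate-linear map $C:\mathcal H\to\mathcal H$ with $C^2=I$ and $\langle Cx,Cy\rangle=\langle y,x\rangle$ for all $x,y\in\mathcal H$; a bounded operator $T$ on $\mathcal H$ is $C$-symmetric if $C$ is a conjugation and $CT^*C=T$. Let $$(W_0f)(w)=\frac1w\,\overline{f\!\left(\frac1{\overline w}\right)},\qquad f\in H^2(\mathbb{C}_+),\ w\in\mathbb{C}_+,$$ which maps $H^2(\mathbb{C}_+)$ into itself. Let $\phi(w)=aw+b$ with $a\in(0,1)\cup(1,\infty)$ and $\operatorname{Re}b=0$, let $\tau(w)=w+(1-a)^{-1}b$, and let $W_{a,b}=C_\tau^{-1}W_0C_\tau$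 on $H^2(\mathbb{C}_+)$. Then (a) $W_{a,b}$ is a conjugation on $H^2(\mathbb{C}_+)$; (b) $C_\phi$ is $W_{a,b}$-symmetric on $H^2(\mathbb{C}_+)$. -/

import Mathlib

open MeasureTheory Set Filter Topology
open scoped ENNReal ComplexConjugate

/-- The open right half-plane. -/
def rightHalfPlane : Set ℂ := {w | 0 < w.re}

/-- The square of the Hardy norm on the right half-plane, with values in `[0, ∞]`. -/
noncomputable def hardySq (f : ℂ → ℂ) : ℝ≥0∞ :=
  ⨆ (x : ℝ) (_ : 0 < x), ENNReal.ofReal (1 / Real.pi) * ∫⁻ y : ℝ, ‖f (x + y * Complex.I)‖ₑ ^ 2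

/-- The property of being a member of the Hardy space; a function on the right half-plane is
encoded as its extension by zero to the whole plane. -/
structure MemHardy (f : ℂ → ℂ) : Prop where
  diff : DifferentiableOn ℂ f rightHalfPlane
  zero_of_notMem : ∀ w, w ∉ rightHalfPlane → f w = 0
  finite : hardySq f < ⊤

namespace HardyAux

/-- The unnormalised square integral over the vertical line through `x`. -/
noncomputable def sl (f : ℂ → ℂ) (x : ℝ) : ℝ≥0∞ := ∫⁻ y : ℝ, ‖f (x + y * Complex.I)‖ₑ ^ 2

lemma isOpen_rhp : IsOpen rightHalfPlane := isOpen_lt continuous_const Complex.continuous_re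

lemma mem_rhp {x : ℝ} (hx : 0 < x) (y : ℝ) : (x + y * Complex.I : ℂ) ∈ rightHalfPlane := by
  simpa [rightHalfPlane] using hx

lemma hardySq_eq (f : ℂ → ℂ) :
    hardySq f = ENNReal.ofReal (1 / Real.pi) * ⨆ x : Ioi (0 : ℝ), sl f x := by
  rw [ENNReal.mul_iSup, iSup_subtype]
  rfl

lemma c_ne_zero : ENNReal.ofReal (1 / Real.pi) ≠ 0 := by
  have := Real.pi_pos
  simp [this]

lemma sl_le {f : ℂ → ℂ} {x : ℝ} (hx : 0 < x) :
    sl f x ≤ ENNReal.ofReal Real.pi * hardySq f := by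
  rw [hardySq_eq, ← mul_assoc, ← ENNReal.ofReal_mul Real.pi_pos.le,
    mul_one_div_cancel Real.pi_pos.ne', ENNReal.ofReal_one, one_mul]
  exact le_iSup (fun x : Ioi (0 : ℝ) => sl f x) ⟨x, hx⟩

lemma sl_lt_top {f : ℂ → ℂ} (hf : MemHardy f) {x : ℝ} (hx : 0 < x) : sl f x < ⊤ :=
  (sl_le hx).trans_lt (ENNReal.mul_lt_top ENNReal.ofReal_lt_top hf.finite)

lemma cont_line {f : ℂ → ℂ} (hf : DifferentiableOn ℂ f rightHalfPlane) {w : ℂ} (hw : 0 < w.re) :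
    Continuous fun y : ℝ => f (w + y * Complex.I) := by
  refine hf.continuousOn.comp_continuous (by fun_prop) fun y => ?_
  simpa [rightHalfPlane] using hw

lemma sl_translate (f : ℂ → ℂ) (w : ℂ) :
    ∫⁻ y : ℝ, ‖f (w + y * Complex.I)‖ₑ ^ 2 = sl f w.re := by
  rw [sl, ← lintegral_add_right_eq_self (fun y : ℝ => ‖f (w.re + y * Complex.I)‖ₑ ^ 2) w.im]
  refine lintegral_congr fun y => ?_
  congr 3
  apply Complex.ext <;> simp [add_comm]

lemma holder_aux {R : ℝ} {u v : ℝ → ℂ} (hu : Continuous u) (hv : Continuous v) :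
    ‖∫ y in (-R)..R, u y * v y‖ₑ ≤
      (∫⁻ y, ‖u y‖ₑ ^ 2) ^ (1 / 2 : ℝ) * (∫⁻ y in uIoc (-R) R, ‖v y‖ₑ ^ 2) ^ (1 / 2 : ℝ) := by
  have h2 : Real.HolderConjugate 2 2 := Real.HolderConjugate.two_two
  calc ‖∫ y in (-R)..R, u y * v y‖ₑ = ‖∫ y in uIoc (-R) R, u y * v y‖ₑ := by
        rw [enorm_eq_iff_norm_eq, intervalIntegral.norm_intervalIntegral_eq]
    _ ≤ ∫⁻ y in uIoc (-R) R, ‖u y * v y‖ₑ := enorm_integral_le_lintegral_enorm _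
    _ = ∫⁻ y in uIoc (-R) R, ((fun y => ‖u y‖ₑ) * fun y => ‖v y‖ₑ) y := by simp [enorm_mul]
    _ ≤ _ := by
        refine (ENNReal.lintegral_mul_le_Lp_mul_Lq _ h2 ?_ ?_).trans ?_
        · exact hu.enorm.aemeasurable
        · exact hv.enorm.aemeasurable
        · simp only [ENNReal.rpow_ofNat]
          gcongr
          exact Measure.restrict_le_self

lemma conv_diff {f : ℂ → ℂ} (hf : DifferentiableOn ℂ f rightHalfPlane) {v : ℝ → ℂ}
    (hv : Continuous v) (R : ℝ) {w : ℂ} (hw : 0 < w.re) :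
    DifferentiableAt ℂ (fun z => ∫ y in (-R)..R, f (z + y * Complex.I) * v y) w := by
  have hder : DifferentiableOn ℂ (deriv f) rightHalfPlane := hf.deriv isOpen_rhp
  have hcompact : IsCompact ((fun p : ℂ × ℝ => p.1 + p.2 * Complex.I) ''
      (Metric.closedBall w (w.re / 2) ×ˢ uIcc (-R) R)) :=
    ((isCompact_closedBall _ _).prod isCompact_uIcc).image (by fun_prop)
  have hball : ∀ z ∈ Metric.closedBall w (w.re / 2), 0 < z.re := by
    intro z hz
    have h1 := Complex.abs_re_le_norm (z - w)
    rw [Metric.mem_closedBall, dist_eq_norm] at hz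
    rw [Complex.sub_re] at h1
    have := (abs_le.1 (h1.trans hz)).1
    linarith
  have hsub : ((fun p : ℂ × ℝ => p.1 + p.2 * Complex.I) ''
      (Metric.closedBall w (w.re / 2) ×ˢ uIcc (-R) R)) ⊆ rightHalfPlane := by
    rintro _ ⟨⟨z, y⟩, ⟨hz, -⟩, rfl⟩
    simpa [rightHalfPlane] using hball z hz
  obtain ⟨B, hB⟩ := hcompact.exists_bound_of_continuousOn (hder.continuousOn.mono hsub)
  have hs : Metric.closedBall w (w.re / 2) ∈ 𝓝 w := Metric.closedBall_mem_nhds _ (by linarith)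
  refine (intervalIntegral.hasDerivAt_integral_of_dominated_loc_of_deriv_le
    (F := fun z y => f (z + y * Complex.I) * v y)
    (F' := fun z y => deriv f (z + y * Complex.I) * v y) (bound := fun y => B * ‖v y‖)
    hs ?_ ?_ ?_ ?_ ?_ ?_).2.differentiableAt
  · filter_upwards [hs] with z hz
    exact ((cont_line hf (hball z hz)).mul hv).aestronglyMeasurable
  · exact ((cont_line hf hw).mul hv).intervalIntegrable _ _
  · exact ((cont_line hder hw).mul hv).aestronglyMeasurable
  · refine Eventually.of_forall fun y hy z hz => ?_
    rw [norm_mul]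
    gcongr
    exact hB _ ⟨(z, y), ⟨hz, uIoc_subset_uIcc hy⟩, rfl⟩
  · exact (continuous_const.mul hv.norm).intervalIntegrable _ _
  · refine Eventually.of_forall fun y hy z hz => ?_
    have hmem : z + y * Complex.I ∈ rightHalfPlane := by
      simpa [rightHalfPlane] using hball z hz
    have h1 := (hf.differentiableAt (isOpen_rhp.mem_nhds hmem)).hasDerivAt
    exact (h1.comp_add_const z (y * Complex.I)).mul_const _

/-- The square integrals over vertical lines decrease from left to right. -/
lemma sl_anti {f : ℂ → ℂ} (hf : MemHardy f) {x₀ x : ℝ} (h₀ : 0 < x₀) (hx : x₀ ≤ x) :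
    sl f x ≤ sl f x₀ := by
  have hxp : 0 < x := h₀.trans_le hx
  have hxc : Continuous fun y : ℝ => f (x + y * Complex.I) :=
    cont_line hf.diff (w := (x : ℂ)) (by simpa using hxp)
  have key : ∀ n : ℕ, ∫⁻ y in Ioc (-(n : ℝ)) n, ‖f (x + y * Complex.I)‖ₑ ^ 2 ≤ sl f x₀ := by
    intro n
    obtain ⟨R, hR⟩ : ∃ R : ℝ, R = (n : ℝ) := ⟨_, rfl⟩
    have hRR : -R ≤ R := by
      have : (0 : ℝ) ≤ R := hR ▸ Nat.cast_nonneg n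
      linarith
    rw [← hR]
    set v : ℝ → ℂ := fun y => conj (f (x + y * Complex.I)) with hv
    have hvc : Continuous v := Complex.continuous_conj.comp hxc
    set A : ℝ≥0∞ := ∫⁻ y in Ioc (-R) R, ‖f (x + y * Complex.I)‖ₑ ^ 2 with hA
    have hAtop : A ≠ ⊤ := ((setLIntegral_le_lintegral _ _).trans_lt (sl_lt_top hf hxp)).ne
    have hvA : ∫⁻ y in uIoc (-R) R, ‖v y‖ₑ ^ 2 = A := by
      rw [uIoc_of_le hRR]
      simp [hA, hv]
    set F : ℂ → ℂ := fun z => ∫ y in (-R)..R, f (z + y * Complex.I) * v y with hF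
    have hFb : ∀ z : ℂ, 0 < z.re → ‖F z‖ₑ ≤ sl f z.re ^ (1 / 2 : ℝ) * A ^ (1 / 2 : ℝ) := by
      intro z hz
      refine (holder_aux (cont_line hf.diff hz) hvc).trans ?_
      rw [hvA, sl_translate]
    have hFx : ‖F x‖ₑ = A := by
      have h1 : F x = ((∫ y in Ioc (-R) R, ‖f (x + y * Complex.I)‖ ^ 2 : ℝ) : ℂ) := by
        simp only [hF, hv]
        rw [intervalIntegral.integral_of_le hRR, ← integral_complex_ofReal]
        refine integral_congr_ae (Eventually.of_forall fun y => ?_)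
        simp [Complex.mul_conj, Complex.normSq_eq_norm_sq]
      have h0 : 0 ≤ ∫ y in Ioc (-R) R, ‖f (x + y * Complex.I)‖ ^ 2 :=
        integral_nonneg fun y => by positivity
      rw [h1, ← ofReal_norm, Complex.norm_real, Real.norm_of_nonneg h0,
        ofReal_integral_eq_lintegral_ofReal]
      · refine lintegral_congr fun y => ?_
        rw [ENNReal.ofReal_pow (norm_nonneg _), ofReal_norm]
      · exact ((hxc.norm.pow 2).integrableOn_Icc).mono_set Ioc_subset_Icc_self
      · exact Eventually.of_forall fun y => by positivity
    have hP : ENNReal.ofReal Real.pi * hardySq f ≠ ⊤ :=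
      ENNReal.mul_ne_top ENNReal.ofReal_ne_top hf.finite.ne
    have toR : ∀ {z : ℂ} {S : ℝ≥0∞}, S ≠ ⊤ → ‖F z‖ₑ ≤ S ^ (1 / 2 : ℝ) * A ^ (1 / 2 : ℝ) →
        ‖F z‖ ≤ (S ^ (1 / 2 : ℝ) * A ^ (1 / 2 : ℝ)).toReal := by
      intro z S hS h
      rw [← toReal_enorm]
      exact ENNReal.toReal_mono (ENNReal.mul_ne_top
        (ENNReal.rpow_ne_top_of_nonneg (by norm_num) hS)
        (ENNReal.rpow_ne_top_of_nonneg (by norm_num) hAtop)) h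
    have hbd : ∀ z : ℂ, 0 < z.re → ‖F z‖ ≤
        ((ENNReal.ofReal Real.pi * hardySq f) ^ (1 / 2 : ℝ) * A ^ (1 / 2 : ℝ)).toReal := by
      intro z hz
      refine toR hP ((hFb z hz).trans ?_)
      gcongr
      exact sl_le hz
    have hPL : ‖F (x₀ + ((x - x₀ : ℝ) : ℂ))‖ ≤
        (sl f x₀ ^ (1 / 2 : ℝ) * A ^ (1 / 2 : ℝ)).toReal := by
      refine PhragmenLindelof.right_half_plane_of_bounded_on_real
        (f := fun z : ℂ => F (x₀ + z)) ?_ ?_ ?_ ?_ ?_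
      · refine DifferentiableOn.diffContOnCl fun z hz => ?_
        rw [Complex.closure_setOfPred_lt_re] at hz
        have : 0 < ((x₀ : ℂ) + z).re := by
          have : 0 ≤ z.re := hz
          simp; linarith
        have h1 := conv_diff hf.diff hvc R this
        exact (DifferentiableAt.comp z h1
          ((differentiableAt_const _).add differentiableAt_id)).differentiableWithinAt
      · refine ⟨0, by norm_num, 0, Asymptotics.IsBigO.of_bound
          ((ENNReal.ofReal Real.pi * hardySq f) ^ (1 / 2 : ℝ) * A ^ (1 / 2 : ℝ)).toReal ?_⟩
        refine Filter.Eventually.filter_mono inf_le_right ?_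
        refine eventually_principal.2 fun z hz => ?_
        have : 0 < ((x₀ : ℂ) + z).re := by
          have : 0 < z.re := hz
          simp; linarith
        simpa using hbd _ this
      · refine ⟨((ENNReal.ofReal Real.pi * hardySq f) ^ (1 / 2 : ℝ) * A ^ (1 / 2 : ℝ)).toReal, ?_⟩
        rw [eventually_map]
        filter_upwards [eventually_ge_atTop (0 : ℝ)] with t ht
        refine hbd _ ?_
        simp; linarith
      · intro t
        refine toR (sl_lt_top hf h₀).ne ((hFb _ (by simpa using h₀)).trans ?_)
        simp
      · simpa using hx
    have e1 : ((x₀ : ℂ) + ((x - x₀ : ℝ) : ℂ)) = x := by push_cast; ring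
    rw [e1] at hPL
    have hle : A ≤ sl f x₀ ^ (1 / 2 : ℝ) * A ^ (1 / 2 : ℝ) := by
      have h3 := ENNReal.ofReal_le_ofReal hPL
      rwa [ofReal_norm, hFx, ENNReal.ofReal_toReal] at h3
      exact ENNReal.mul_ne_top
        (ENNReal.rpow_ne_top_of_nonneg (by norm_num) (sl_lt_top hf h₀).ne)
        (ENNReal.rpow_ne_top_of_nonneg (by norm_num) hAtop)
    by_cases hA0 : A = 0
    · rw [hA0]; exact zero_le
    have hhalf : A = A ^ (1 / 2 : ℝ) * A ^ (1 / 2 : ℝ) := by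
      rw [← ENNReal.rpow_add _ _ hA0 hAtop]; norm_num
    have hAh0 : A ^ (1 / 2 : ℝ) ≠ 0 := by simp [hA0]
    have hAht : A ^ (1 / 2 : ℝ) ≠ ⊤ := ENNReal.rpow_ne_top_of_nonneg (by norm_num) hAtop
    have h4 : A ^ (1 / 2 : ℝ) ≤ sl f x₀ ^ (1 / 2 : ℝ) := by
      rw [← ENNReal.mul_le_mul_iff_left hAh0 hAht, ← hhalf]; exact hle
    exact (ENNReal.rpow_le_rpow_iff (by norm_num)).1 h4
  have hcov : AECover (volume : Measure ℝ) atTop fun n : ℕ => Ioc (-(n : ℝ)) n :=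
    aecover_Ioc (tendsto_neg_atTop_atBot.comp tendsto_natCast_atTop_atTop)
      tendsto_natCast_atTop_atTop
  exact le_of_tendsto' (hcov.lintegral_tendsto_of_countably_generated
    (hxc.enorm.measurable.pow_const 2).aemeasurable) key

lemma sl_parallelogram {f g : ℂ → ℂ} (hf : MemHardy f) (hg : MemHardy g) {x : ℝ} (hx : 0 < x) :
    sl (f + g) x + sl (f - g) x = 2 * (sl f x + sl g x) := by
  have hfc : Continuous fun y : ℝ => f (x + y * Complex.I) :=
    cont_line hf.diff (w := (x : ℂ)) (by simpa using hx)
  have hgc : Continuous fun y : ℝ => g (x + y * Complex.I) :=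
    cont_line hg.diff (w := (x : ℂ)) (by simpa using hx)
  simp only [sl, Pi.add_apply, Pi.sub_apply]
  have hm1 : Measurable fun y : ℝ => ‖f (x + y * Complex.I) + g (x + y * Complex.I)‖ₑ ^ 2 :=
    (hfc.add hgc).enorm.measurable.pow_const 2
  have hm2 : Measurable fun y : ℝ => ‖f (x + y * Complex.I)‖ₑ ^ 2 :=
    hfc.enorm.measurable.pow_const 2
  have hm3 : Measurable fun y : ℝ => ‖g (x + y * Complex.I)‖ₑ ^ 2 :=
    hgc.enorm.measurable.pow_const 2
  rw [← lintegral_add_left hm1, ← lintegral_add_left hm2, ← lintegral_const_mul]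
  · refine lintegral_congr fun y => ?_
    simp only [← ofReal_norm]
    rw [← ENNReal.ofReal_pow (norm_nonneg _), ← ENNReal.ofReal_pow (norm_nonneg _),
      ← ENNReal.ofReal_pow (norm_nonneg _), ← ENNReal.ofReal_pow (norm_nonneg _),
      ← ENNReal.ofReal_add (by positivity) (by positivity),
      ← ENNReal.ofReal_add (by positivity) (by positivity),
      show (2 : ℝ≥0∞) = ENNReal.ofReal 2 by simp, ← ENNReal.ofReal_mul (by norm_num)]
    congr 1
    have := parallelogram_law_with_norm ℝ (f (x + y * Complex.I)) (g (x + y * Complex.I))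
    nlinarith [this]
  · exact hm2.add hm3

lemma hardySq_smul (c : ℂ) (f : ℂ → ℂ) : hardySq (c • f) = ‖c‖ₑ ^ 2 * hardySq f := by
  have : ∀ x, sl (c • f) x = ‖c‖ₑ ^ 2 * sl f x := by
    intro x
    simp only [sl, Pi.smul_apply, smul_eq_mul, enorm_mul, mul_pow]
    exact lintegral_const_mul' _ _ (by simp)
  simp only [hardySq_eq, this]
  rw [← ENNReal.mul_iSup]
  ring

lemma memHardy_smul (c : ℂ) {f : ℂ → ℂ} (hf : MemHardy f) : MemHardy (c • f) where
  diff := hf.diff.const_smul c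
  zero_of_notMem w hw := by simp [hf.zero_of_notMem w hw]
  finite := by
    rw [hardySq_smul]
    exact ENNReal.mul_lt_top (by simp) hf.finite

lemma memHardy_add {f g : ℂ → ℂ} (hf : MemHardy f) (hg : MemHardy g) : MemHardy (f + g) where
  diff := hf.diff.add hg.diff
  zero_of_notMem w hw := by simp [hf.zero_of_notMem w hw, hg.zero_of_notMem w hw]
  finite := by
    have h : ∀ x : Ioi (0 : ℝ), sl (f + g) x ≤
        2 * (ENNReal.ofReal Real.pi * hardySq f + ENNReal.ofReal Real.pi * hardySq g) := by
      intro x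
      calc sl (f + g) x ≤ sl (f + g) x + sl (f - g) x := le_self_add
        _ = 2 * (sl f x + sl g x) := sl_parallelogram hf hg x.2
        _ ≤ _ := by gcongr <;> exact sl_le x.2
    rw [hardySq_eq]
    refine ENNReal.mul_lt_top ENNReal.ofReal_lt_top ((iSup_le h).trans_lt ?_)
    refine ENNReal.mul_lt_top (by simp) (ENNReal.add_lt_top.2 ⟨?_, ?_⟩)
    · exact ENNReal.mul_lt_top ENNReal.ofReal_lt_top hf.finite
    · exact ENNReal.mul_lt_top ENNReal.ofReal_lt_top hg.finite

lemma memHardy_zero : MemHardy 0 where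
  diff := differentiableOn_const 0
  zero_of_notMem _ _ := rfl
  finite := by simp [hardySq]

lemma hardySq_parallelogram {f g : ℂ → ℂ} (hf : MemHardy f) (hg : MemHardy g) :
    hardySq (f + g) + hardySq (f - g) = 2 * (hardySq f + hardySq g) := by
  have hs : MemHardy (f - g) := by
    have := memHardy_add hf (memHardy_smul (-1) hg)
    simpa [sub_eq_add_neg] using this
  have hdir : ∀ {u v : ℂ → ℂ}, MemHardy u → MemHardy v →
      (⨆ x : Ioi (0 : ℝ), sl u x) + (⨆ x : Ioi (0 : ℝ), sl v x)
        = ⨆ x : Ioi (0 : ℝ), (sl u x + sl v x) := by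
    intro u v hu hv
    refine ENNReal.iSup_add_iSup fun i j => ⟨⟨min i.1 j.1, lt_min (mem_Ioi.1 i.2) (mem_Ioi.1 j.2)⟩, ?_⟩
    have hi : 0 < i.1 := i.2
    have hj : 0 < j.1 := j.2
    exact add_le_add (sl_anti hu (lt_min hi hj) (min_le_left _ _))
      (sl_anti hv (lt_min hi hj) (min_le_right _ _))
  simp only [hardySq_eq]
  rw [← mul_add, hdir (memHardy_add hf hg) hs, ← mul_add, hdir hf hg, mul_left_comm]
  congr 1
  rw [ENNReal.mul_iSup]
  exact iSup_congr fun x => sl_parallelogram hf hg x.2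

end HardyAux

namespace HardyAux

lemma measurable_memHardy {f : ℂ → ℂ} (hf : MemHardy f) : Measurable f := by
  classical
  have h : f = rightHalfPlane.piecewise f 0 := by
    ext w
    by_cases hw : w ∈ rightHalfPlane
    · simp [hw]
    · simp [hw, hf.zero_of_notMem w hw]
  rw [h]
  exact hf.diff.continuousOn.measurable_piecewise continuousOn_const isOpen_rhp.measurableSet

lemma circle_le {f : ℂ → ℂ} (hf : MemHardy f) {w : ℂ} {r : ℝ} (hr : 0 < r) (hrw : r < w.re) :
    ENNReal.ofReal (2 * Real.pi) * ‖f w‖ₑ ^ 2 ≤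
      ∫⁻ θ in Ioo (-Real.pi) Real.pi, ‖f (w + r * (Real.cos θ + Real.sin θ * Complex.I))‖ₑ ^ 2 := by
  have hd : DiffContOnCl ℂ (fun z => f z ^ 2) (Metric.ball w |r|) := by
    refine DifferentiableOn.diffContOnCl ((hf.diff.pow 2).mono ?_)
    intro z hz
    rw [abs_of_pos hr] at hz
    have hz := Metric.closure_ball_subset_closedBall hz
    rw [Metric.mem_closedBall, dist_eq_norm] at hz
    have h1 := (abs_le.1 ((Complex.abs_re_le_norm (z - w)).trans hz)).1
    rw [Complex.sub_re] at h1
    change 0 < z.re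
    linarith
  have h1 := hd.circleAverage
  rw [Real.circleAverage_eq_integral_add (-Real.pi)] at h1
  rw [intervalIntegral.integral_comp_add_right (fun θ => f (circleMap w r θ) ^ 2)] at h1
  rw [show (0 : ℝ) + -Real.pi = -Real.pi by ring,
    show 2 * Real.pi + -Real.pi = Real.pi by ring] at h1
  have hpi : (0 : ℝ) < 2 * Real.pi := by positivity
  have h2 : ∫ θ in (-Real.pi)..Real.pi, f (circleMap w r θ) ^ 2
      = (2 * Real.pi) • f w ^ 2 := by
    rw [← h1, smul_smul, mul_inv_cancel₀ hpi.ne', one_smul]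
  calc ENNReal.ofReal (2 * Real.pi) * ‖f w‖ₑ ^ 2 = ‖(2 * Real.pi) • f w ^ 2‖ₑ := by
        rw [enorm_smul, enorm_pow, Real.enorm_eq_ofReal hpi.le]
    _ = ‖∫ θ in Ioo (-Real.pi) Real.pi, f (circleMap w r θ) ^ 2‖ₑ := by
        rw [← h2, intervalIntegral.integral_of_le (by linarith), integral_Ioc_eq_integral_Ioo]
    _ ≤ ∫⁻ θ in Ioo (-Real.pi) Real.pi, ‖f (circleMap w r θ) ^ 2‖ₑ :=
        enorm_integral_le_lintegral_enorm _
    _ = _ := by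
        refine lintegral_congr fun θ => ?_
        rw [enorm_pow, circleMap, Complex.exp_mul_I, Complex.ofReal_cos, Complex.ofReal_sin]

lemma point_bound {f : ℂ → ℂ} (hf : MemHardy f) {w : ℂ} {R : ℝ} (hR : 0 < R) (hRw : R < w.re) :
    ENNReal.ofReal (R ^ 2 * Real.pi) * ‖f w‖ₑ ^ 2 ≤
      ENNReal.ofReal (2 * R * Real.pi) * hardySq f := by
  set G : ℂ → ℝ≥0∞ := (Metric.ball (0 : ℂ) R).indicator fun z => ‖f (w + z)‖ₑ ^ 2 with hG
  have hfm := measurable_memHardy hf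
  have hGm : Measurable G :=
    Measurable.indicator ((hfm.comp (measurable_const_add w)).enorm.pow_const 2)
      Metric.isOpen_ball.measurableSet
  -- lower bound in polar coordinates
  have hlow : ENNReal.ofReal (R ^ 2 * Real.pi) * ‖f w‖ₑ ^ 2 ≤ ∫⁻ z, G z := by
    rw [← Complex.lintegral_comp_polarCoord_symm]
    have hpc : Measurable fun p : ℝ × ℝ => Complex.polarCoord.symm p := by
      simp only [Complex.polarCoord_symm_apply]
      fun_prop
    have hm : Measurable fun p : ℝ × ℝ =>
        ENNReal.ofReal p.1 • G (Complex.polarCoord.symm p) :=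
      measurable_fst.ennreal_ofReal.mul (hGm.comp hpc)
    rw [polarCoord_target, Measure.volume_eq_prod, ← Measure.prod_restrict,
      lintegral_prod _ hm.aemeasurable]
    have hin : ∀ r ∈ Ioo 0 R, ENNReal.ofReal r * (ENNReal.ofReal (2 * Real.pi) * ‖f w‖ₑ ^ 2) ≤
        ∫⁻ θ in Ioo (-Real.pi) Real.pi,
          ENNReal.ofReal (r, θ).1 • G (Complex.polarCoord.symm (r, θ)) := by
      intro r hr
      simp only [smul_eq_mul]
      rw [lintegral_const_mul' _ _ ENNReal.ofReal_ne_top]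
      gcongr
      refine (circle_le hf hr.1 (hr.2.trans hRw)).trans_eq (lintegral_congr fun θ => ?_)
      have hmem : Complex.polarCoord.symm (r, θ) ∈ Metric.ball (0 : ℂ) R := by
        rw [mem_ball_zero_iff, Complex.norm_polarCoord_symm, abs_of_pos hr.1]
        exact hr.2
      rw [hG, indicator_of_mem hmem, Complex.polarCoord_symm_apply]
    have hr : ∫⁻ r in Ioo 0 R, ENNReal.ofReal r = ENNReal.ofReal (R ^ 2 / 2) := by
      rw [← ofReal_integral_eq_lintegral_ofReal, ← integral_Ioc_eq_integral_Ioo,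
        ← intervalIntegral.integral_of_le hR.le, integral_id]
      · simp
      · exact (continuous_id.integrableOn_Icc).mono_set Ioo_subset_Icc_self
      · exact (ae_restrict_iff' measurableSet_Ioo).2 (Eventually.of_forall fun r hr => hr.1.le)
    calc ENNReal.ofReal (R ^ 2 * Real.pi) * ‖f w‖ₑ ^ 2
        = ENNReal.ofReal (R ^ 2 / 2) * (ENNReal.ofReal (2 * Real.pi) * ‖f w‖ₑ ^ 2) := by
          rw [← mul_assoc, ← ENNReal.ofReal_mul (by positivity)]
          congr 2
          ring
      _ = ∫⁻ r in Ioo 0 R, ENNReal.ofReal r * (ENNReal.ofReal (2 * Real.pi) * ‖f w‖ₑ ^ 2) := by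
          rw [lintegral_mul_const _ ENNReal.measurable_ofReal, hr]
      _ ≤ ∫⁻ r in Ioo 0 R, ∫⁻ θ in Ioo (-Real.pi) Real.pi,
          ENNReal.ofReal (r, θ).1 • G (Complex.polarCoord.symm (r, θ)) :=
          setLIntegral_mono' measurableSet_Ioo hin
      _ ≤ _ := lintegral_mono_set Ioo_subset_Ioi_self
  refine hlow.trans ?_
  -- upper bound in Cartesian coordinates
  rw [← (Complex.volume_preserving_equiv_real_prod.symm).lintegral_comp_emb
    Complex.measurableEquivRealProd.symm.measurableEmbedding, Measure.volume_eq_prod,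
    lintegral_prod (fun p : ℝ × ℝ => G (Complex.measurableEquivRealProd.symm p))
      (hGm.comp Complex.measurableEquivRealProd.symm.measurable).aemeasurable]
  have hx : ∀ x : ℝ, ∫⁻ y : ℝ, G (Complex.measurableEquivRealProd.symm (x, y)) ≤
      (Ioo (-R) R).indicator (fun _ => ENNReal.ofReal Real.pi * hardySq f) x := by
    intro x
    have hmk : ∀ y : ℝ, Complex.measurableEquivRealProd.symm (x, y) = x + y * Complex.I :=
      fun y => by rw [Complex.measurableEquivRealProd_symm_apply, Complex.mk_eq_add_mul_I]
    by_cases hxR : x ∈ Ioo (-R) R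
    · rw [indicator_of_mem hxR]
      have hp : 0 < (w + x).re := by
        rw [Complex.add_re, Complex.ofReal_re]; linarith [hxR.1]
      refine (lintegral_mono (g := fun y : ℝ => ‖f ((w + x) + y * Complex.I)‖ₑ ^ 2)
        fun y => ?_).trans ?_
      · rw [hmk, hG]
        refine (indicator_le_self _ _ _).trans_eq ?_
        rw [← add_assoc]
      · rw [sl_translate]
        exact sl_le hp
    · rw [indicator_of_notMem hxR]
      refine le_of_eq ?_
      rw [lintegral_eq_zero_of_ae_eq_zero]
      refine Eventually.of_forall fun y => ?_
      change G (Complex.measurableEquivRealProd.symm (x, y)) = 0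
      rw [hmk, hG]
      refine indicator_of_notMem (fun h => hxR ?_) _
      rw [mem_ball_zero_iff] at h
      have := (Complex.abs_re_le_norm _).trans_lt h
      simp only [Complex.add_re, Complex.ofReal_re, Complex.mul_re, Complex.I_re, mul_zero,
        Complex.ofReal_im, Complex.I_im, mul_one, sub_self, add_zero] at this
      exact abs_lt.1 this
  refine (lintegral_mono hx).trans_eq ?_
  rw [lintegral_indicator measurableSet_Ioo, setLIntegral_const, Real.volume_Ioo,
    mul_right_comm, ← ENNReal.ofReal_mul Real.pi_pos.le]
  congr 2
  ring

lemma hardySq_add_rpow_le {f g : ℂ → ℂ} (hf : MemHardy f) (hg : MemHardy g) :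
    hardySq (f + g) ^ (1 / 2 : ℝ) ≤ hardySq f ^ (1 / 2 : ℝ) + hardySq g ^ (1 / 2 : ℝ) := by
  have hsc : ∀ u : ℂ → ℂ, ∀ x : ℝ, 0 < x →
      (ENNReal.ofReal (1 / Real.pi) * sl u x) ^ (1 / 2 : ℝ) ≤ hardySq u ^ (1 / 2 : ℝ) := by
    intro u x hx
    refine ENNReal.rpow_le_rpow ?_ (by norm_num)
    exact le_iSup₂_of_le x hx le_rfl
  have hmain : hardySq (f + g) ≤
      (hardySq f ^ (1 / 2 : ℝ) + hardySq g ^ (1 / 2 : ℝ)) ^ (2 : ℝ) := by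
    refine iSup₂_le fun x hx => ?_
    have hfc : Continuous fun y : ℝ => f (x + y * Complex.I) :=
      cont_line hf.diff (w := (x : ℂ)) (by simpa using hx)
    have hgc : Continuous fun y : ℝ => g (x + y * Complex.I) :=
      cont_line hg.diff (w := (x : ℂ)) (by simpa using hx)
    change ENNReal.ofReal (1 / Real.pi) * sl (f + g) x ≤ _
    have h1 : sl (f + g) x ^ (1 / 2 : ℝ) ≤ sl f x ^ (1 / 2 : ℝ) + sl g x ^ (1 / 2 : ℝ) := by
      have h2 := ENNReal.lintegral_Lp_add_le (μ := volume) (p := 2)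
        hfc.enorm.aemeasurable hgc.enorm.aemeasurable (by norm_num)
      simp only [ENNReal.rpow_ofNat, Pi.add_apply] at h2
      refine le_trans (ENNReal.rpow_le_rpow (lintegral_mono fun y => ?_) (by norm_num)) h2
      gcongr
      exact enorm_add_le _ _
    have h3 : (ENNReal.ofReal (1 / Real.pi) * sl (f + g) x) ^ (1 / 2 : ℝ) ≤
        hardySq f ^ (1 / 2 : ℝ) + hardySq g ^ (1 / 2 : ℝ) := by
      refine le_trans ?_ (add_le_add (hsc f x hx) (hsc g x hx))
      simp only [ENNReal.mul_rpow_of_nonneg _ _ (show (0 : ℝ) ≤ 1 / 2 by norm_num)]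
      rw [← mul_add]
      gcongr
    calc ENNReal.ofReal (1 / Real.pi) * sl (f + g) x
        = ((ENNReal.ofReal (1 / Real.pi) * sl (f + g) x) ^ (1 / 2 : ℝ)) ^ (2 : ℝ) := by
          rw [← ENNReal.rpow_mul]; norm_num
      _ ≤ _ := ENNReal.rpow_le_rpow h3 (by norm_num)
  calc hardySq (f + g) ^ (1 / 2 : ℝ)
      ≤ ((hardySq f ^ (1 / 2 : ℝ) + hardySq g ^ (1 / 2 : ℝ)) ^ (2 : ℝ)) ^ (1 / 2 : ℝ) :=
        ENNReal.rpow_le_rpow hmain (by norm_num)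
    _ = _ := by rw [← ENNReal.rpow_mul]; norm_num

end HardyAux

/-- The Hardy space as a vector space of functions. -/
def hardySubmodule : Submodule ℂ (ℂ → ℂ) where
  carrier := {f | MemHardy f}
  add_mem' := HardyAux.memHardy_add
  zero_mem' := HardyAux.memHardy_zero
  smul_mem' c _ hf := HardyAux.memHardy_smul c hf

/-- The Hardy space `H²` of the right half-plane. -/
def HardyH2 : Type := hardySubmodule

namespace HardyH2

noncomputable instance : AddCommGroup HardyH2 := inferInstanceAs (AddCommGroup hardySubmodule)

noncomputable instance : Module ℂ HardyH2 := inferInstanceAs (Module ℂ hardySubmodule)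

/-- The function underlying an element of the Hardy space. -/
def toFun (f : HardyH2) : ℂ → ℂ := f.1

instance : CoeFun HardyH2 fun _ => ℂ → ℂ := ⟨toFun⟩

/-- An element of the Hardy space from a function. -/
def mk (f : ℂ → ℂ) (hf : MemHardy f) : HardyH2 := ⟨f, hf⟩

@[simp] lemma mk_apply (f : ℂ → ℂ) (hf : MemHardy f) (w : ℂ) : mk f hf w = f w := rfl

/-- The Hardy norm. -/
noncomputable instance : Norm HardyH2 := ⟨fun f => Real.sqrt (hardySq f).toReal⟩

lemma mem (f : HardyH2) : MemHardy f := f.2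

lemma ext {f g : HardyH2} (h : ∀ w ∈ rightHalfPlane, f w = g w) : f = g := by
  refine Subtype.ext (funext fun w => ?_)
  by_cases hw : w ∈ rightHalfPlane
  · exact h w hw
  · change f w = g w
    rw [f.mem.zero_of_notMem w hw, g.mem.zero_of_notMem w hw]

@[simp] lemma add_apply (f g : HardyH2) (w : ℂ) : (f + g) w = f w + g w := rfl

@[simp] lemma sub_apply (f g : HardyH2) (w : ℂ) : (f - g) w = f w - g w := rfl

@[simp] lemma smul_apply (c : ℂ) (f : HardyH2) (w : ℂ) : (c • f) w = c * f w := rfl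

lemma norm_def (f : HardyH2) : ‖f‖ = Real.sqrt (hardySq f).toReal := rfl

lemma norm_eq_rpow (f : HardyH2) : ‖f‖ = (hardySq f ^ (1 / 2 : ℝ)).toReal := by
  rw [norm_def, Real.sqrt_eq_rpow, ENNReal.toReal_rpow]

lemma norm_sq (f : HardyH2) : ‖f‖ ^ 2 = (hardySq f).toReal :=
  Real.sq_sqrt ENNReal.toReal_nonneg

lemma norm_apply_sq_le (f : HardyH2) {w : ℂ} {R : ℝ} (hR : 0 < R) (hRw : R < w.re) :
    ‖f w‖ ^ 2 ≤ 2 / R * ‖f‖ ^ 2 := by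
  have h := ENNReal.toReal_mono (ENNReal.mul_ne_top ENNReal.ofReal_ne_top f.mem.finite.ne)
    (HardyAux.point_bound f.mem hR hRw)
  have hpi := Real.pi_pos
  rw [ENNReal.toReal_mul, ENNReal.toReal_mul, ENNReal.toReal_ofReal (by positivity),
    ENNReal.toReal_ofReal (by positivity), ENNReal.toReal_pow, toReal_enorm, ← norm_sq] at h
  have h2 : R * Real.pi * (R * ‖f w‖ ^ 2) ≤ R * Real.pi * (2 * ‖f‖ ^ 2) := by linarith
  have h3 := le_of_mul_le_mul_left h2 (by positivity)
  rw [div_mul_eq_mul_div, le_div_iff₀ hR]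
  linarith

lemma core : NormedSpace.Core ℂ HardyH2 where
  norm_nonneg f := Real.sqrt_nonneg _
  norm_smul c f := by
    rw [norm_def, norm_def, show ((c • f : HardyH2) : ℂ → ℂ) = c • (f : ℂ → ℂ) from rfl,
      HardyAux.hardySq_smul, ENNReal.toReal_mul, Real.sqrt_mul ENNReal.toReal_nonneg,
      ENNReal.toReal_pow, toReal_enorm, Real.sqrt_sq (norm_nonneg c)]
  norm_triangle f g := by
    have hf := f.mem
    have hg := g.mem
    have t : ∀ u : HardyH2, hardySq u ^ (1 / 2 : ℝ) ≠ ⊤ := fun u =>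
      ENNReal.rpow_ne_top_of_nonneg (by norm_num) u.mem.finite.ne
    rw [norm_eq_rpow, norm_eq_rpow, norm_eq_rpow, ← ENNReal.toReal_add (t f) (t g)]
    exact ENNReal.toReal_mono (ENNReal.add_ne_top.2 ⟨t f, t g⟩)
      (HardyAux.hardySq_add_rpow_le hf hg)
  norm_eq_zero_iff f := by
    constructor
    · intro h
      refine ext fun w hw => ?_
      have hw : 0 < w.re := hw
      have h1 := norm_apply_sq_le f (w := w) (half_pos hw) (half_lt_self hw)
      rw [h] at h1
      have h2 : ‖f w‖ ^ 2 = 0 := le_antisymm (by simpa using h1) (by positivity)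
      change f w = 0
      simpa using h2
    · rintro rfl
      rw [norm_def, show ((0 : HardyH2) : ℂ → ℂ) = 0 from rfl]
      simp [hardySq]

noncomputable instance : NormedAddCommGroup HardyH2 := NormedAddCommGroup.ofCore core

noncomputable instance : NormedSpace ℂ HardyH2 := NormedSpace.ofCore core

/-- The inner product that induces the Hardy norm (given by polarization). -/
noncomputable instance : InnerProductSpace ℂ HardyH2 := InnerProductSpace.ofNorm ℂ fun f g : HardyH2 => by
  have h : (hardySq (f + g : HardyH2) + hardySq (f - g : HardyH2)).toReal =
      (2 * (hardySq f + hardySq g)).toReal :=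
    congrArg ENNReal.toReal (HardyAux.hardySq_parallelogram f.mem g.mem)
  have hf := f.mem.finite.ne
  have hg := g.mem.finite.ne
  have ha := (f + g).mem.finite.ne
  have hs := (f - g).mem.finite.ne
  rw [ENNReal.toReal_add ha hs, ENNReal.toReal_mul, ENNReal.toReal_add hf hg] at h
  rw [← sq, ← sq, ← sq, ← sq, norm_sq, norm_sq, norm_sq, norm_sq]
  simpa using h

lemma norm_apply_le (f : HardyH2) {w : ℂ} {R : ℝ} (hR : 0 < R) (hRw : R < w.re) :
    ‖f w‖ ≤ Real.sqrt (2 / R) * ‖f‖ := by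
  refine le_of_sq_le_sq ?_ (by positivity)
  rw [mul_pow, Real.sq_sqrt (by positivity)]
  exact norm_apply_sq_le f hR hRw

instance : CompleteSpace HardyH2 := by
  refine Metric.complete_of_cauchySeq_tendsto fun u hu => ?_
  have hdiff : ∀ R > 0, ∀ ε > 0, ∃ N, ∀ m ≥ N, ∀ n ≥ N, ∀ w : ℂ, R < w.re →
      ‖u m w - u n w‖ < ε := by
    intro R hR ε hε
    have hs : 0 < Real.sqrt (2 / R) := Real.sqrt_pos.2 (by positivity)
    obtain ⟨N, hN⟩ := Metric.cauchySeq_iff.1 hu (ε / Real.sqrt (2 / R)) (by positivity)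
    refine ⟨N, fun m hm n hn w hw => ?_⟩
    have h1 := norm_apply_le (u m - u n) hR hw
    have h2 := hN m hm n hn
    rw [dist_eq_norm, lt_div_iff₀ hs] at h2
    rw [sub_apply] at h1
    linarith
  have hlim : ∀ w : ℂ, ∃ l, Tendsto (fun n => u n w) atTop (𝓝 l) := by
    intro w
    by_cases hw : w ∈ rightHalfPlane
    · have hw : 0 < w.re := hw
      refine cauchySeq_tendsto_of_complete (Metric.cauchySeq_iff.2 fun ε hε => ?_)
      obtain ⟨N, hN⟩ := hdiff (w.re / 2) (half_pos hw) ε hε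
      refine ⟨N, fun m hm n hn => ?_⟩
      rw [dist_eq_norm]
      exact hN m hm n hn w (half_lt_self hw)
    · refine ⟨0, ?_⟩
      simp only [(u _).mem.zero_of_notMem w hw, tendsto_const_nhds]
  choose F hF using hlim
  have hFd : DifferentiableOn ℂ F rightHalfPlane := by
    refine TendstoLocallyUniformlyOn.differentiableOn (F := fun n => (u n : ℂ → ℂ)) (φ := atTop)
      ?_ (Eventually.of_forall fun n => (u n).mem.diff) HardyAux.isOpen_rhp
    rw [Metric.tendstoLocallyUniformlyOn_iff]
    intro ε hε w hw
    have hw : 0 < w.re := hw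
    refine ⟨{z | w.re / 2 < z.re}, mem_nhdsWithin_of_mem_nhds
      ((isOpen_lt continuous_const Complex.continuous_re).mem_nhds (half_lt_self hw)), ?_⟩
    obtain ⟨N, hN⟩ := hdiff (w.re / 2) (half_pos hw) (ε / 2) (half_pos hε)
    filter_upwards [eventually_ge_atTop N] with n hn z hz
    rw [dist_eq_norm]
    have : ‖F z - u n z‖ ≤ ε / 2 := by
      refine le_of_tendsto ((hF z).sub_const (u n z)).norm ?_
      filter_upwards [eventually_ge_atTop N] with m hm
      exact (hN m hm n hn z hz).le
    linarith
  have hF0 : ∀ w, w ∉ rightHalfPlane → F w = 0 := by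
    intro w hw
    refine tendsto_nhds_unique (hF w) ?_
    simp only [(u _).mem.zero_of_notMem w hw, tendsto_const_nhds]
  have hfat : ∀ ε > 0, ∃ N, ∀ n ≥ N,
      hardySq (F - (u n : ℂ → ℂ)) ≤ ENNReal.ofReal (ε ^ 2) := by
    intro ε hε
    obtain ⟨N, hN⟩ := Metric.cauchySeq_iff.1 hu ε hε
    refine ⟨N, fun n hn => iSup₂_le fun x hx => ?_⟩
    have hb : ∀ m ≥ N, ENNReal.ofReal (1 / Real.pi) *
        ∫⁻ y : ℝ, ‖u m (x + y * Complex.I) - u n (x + y * Complex.I)‖ₑ ^ 2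
          ≤ ENNReal.ofReal (ε ^ 2) := by
      intro m hm
      have h1 := hN m hm n hn
      rw [dist_eq_norm] at h1
      have h2 : (hardySq (u m - u n : HardyH2)).toReal ≤ ε ^ 2 := by
        rw [← norm_sq]
        gcongr
      refine le_trans ?_ ((ENNReal.le_ofReal_iff_toReal_le (u m - u n).mem.finite.ne
        (by positivity)).2 h2)
      exact le_iSup₂_of_le x hx le_rfl
    have hmeas : ∀ m, Measurable fun y : ℝ => ENNReal.ofReal (1 / Real.pi) *
        ‖u m (x + y * Complex.I) - u n (x + y * Complex.I)‖ₑ ^ 2 := by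
      intro m
      have h1 := (HardyAux.measurable_memHardy (u m - u n).mem)
      have h2 : Measurable fun y : ℝ => (x + y * Complex.I : ℂ) := by fun_prop
      exact ((h1.comp h2).enorm.pow_const 2).const_mul _
    calc ENNReal.ofReal (1 / Real.pi) *
          ∫⁻ y : ℝ, ‖(F - (u n : ℂ → ℂ)) (x + y * Complex.I)‖ₑ ^ 2
        = ∫⁻ y : ℝ, liminf (fun m => ENNReal.ofReal (1 / Real.pi) *
          ‖u m (x + y * Complex.I) - u n (x + y * Complex.I)‖ₑ ^ 2) atTop := by
          rw [← lintegral_const_mul' _ _ ENNReal.ofReal_ne_top]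
          refine lintegral_congr fun y => ?_
          refine (Tendsto.liminf_eq ?_).symm
          refine ENNReal.Tendsto.const_mul ?_ (Or.inr ENNReal.ofReal_ne_top)
          refine ENNReal.Tendsto.pow ?_
          exact ((hF _).sub_const _).enorm
      _ ≤ liminf (fun m => ∫⁻ y : ℝ, ENNReal.ofReal (1 / Real.pi) *
          ‖u m (x + y * Complex.I) - u n (x + y * Complex.I)‖ₑ ^ 2) atTop :=
          lintegral_liminf_le hmeas
      _ ≤ ENNReal.ofReal (ε ^ 2) := by
          refine liminf_le_of_frequently_le' (Eventually.frequently ?_)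
          filter_upwards [eventually_ge_atTop N] with m hm
          rw [lintegral_const_mul' _ _ ENNReal.ofReal_ne_top]
          exact hb m hm
  have hsub : ∀ n, hardySq (F - (u n : ℂ → ℂ)) < ⊤ → MemHardy (F - (u n : ℂ → ℂ)) := fun n hn =>
    { diff := hFd.sub (u n).mem.diff
      zero_of_notMem := fun w hw => by simp [hF0 w hw, (u n).mem.zero_of_notMem w hw]
      finite := hn }
  have hFm : MemHardy F := by
    obtain ⟨N, hN⟩ := hfat 1 one_pos
    have h1 := hsub N ((hN N le_rfl).trans_lt ENNReal.ofReal_lt_top)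
    have h2 := HardyAux.memHardy_add h1 (u N).mem
    simpa using h2
  refine ⟨mk F hFm, Metric.tendsto_atTop.2 fun ε hε => ?_⟩
  obtain ⟨N, hN⟩ := hfat (ε / 2) (half_pos hε)
  refine ⟨N, fun n hn => ?_⟩
  rw [dist_comm, dist_eq_norm]
  refine lt_of_le_of_lt ?_ (half_lt_self hε)
  refine le_of_sq_le_sq ?_ (half_pos hε).le
  rw [norm_sq]
  change (hardySq (F - (u n : ℂ → ℂ))).toReal ≤ _
  exact ENNReal.toReal_le_of_le_ofReal (by positivity) (hN n hn)

end HardyH2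

namespace HardyAux

lemma affine_re (a : ℝ) (b w : ℂ) : (a * w + b).re = a * w.re + b.re := by simp

lemma affine_mem {a : ℝ} (ha : 0 < a) {b : ℂ} (hb : 0 ≤ b.re) {w : ℂ} (hw : w ∈ rightHalfPlane) :
    a * w + b ∈ rightHalfPlane := by
  have hw : 0 < w.re := hw
  change 0 < (a * w + b).re
  rw [affine_re]
  positivity

/-- The composite `f ∘ φ` on the right half-plane, extended by zero. -/
noncomputable def compFun (φ : ℂ → ℂ) (f : ℂ → ℂ) : ℂ → ℂ :=
  rightHalfPlane.indicator (f ∘ φ)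

lemma sl_comp_affine {a : ℝ} (ha : 0 < a) {b : ℂ} {f : ℂ → ℂ} {x : ℝ} (hx : 0 < x) :
    sl (compFun (fun w => a * w + b) f) x = ENNReal.ofReal a⁻¹ * sl f (a * x + b.re) := by
  have h1 : sl (compFun (fun w => a * w + b) f) x =
      ∫⁻ y : ℝ, ‖f ((a * x + b) + (a * y : ℝ) * Complex.I)‖ₑ ^ 2 := by
    refine lintegral_congr fun y => ?_
    rw [compFun, indicator_of_mem (mem_rhp hx y), Function.comp_apply]
    congr 3
    push_cast
    ring
  rw [h1]
  have h2 := (Homeomorph.mulLeft₀ a ha.ne').measurableEmbedding.lintegral_map (μ := volume)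
    (fun y : ℝ => ‖f ((a * x + b) + y * Complex.I)‖ₑ ^ 2)
  simp only [Homeomorph.coe_mulLeft₀] at h2
  rw [← h2, Real.map_volume_mul_left ha.ne', lintegral_smul_measure, sl_translate,
    abs_of_pos (inv_pos.2 ha), smul_eq_mul]
  simp

lemma hardySq_comp_affine_le {a : ℝ} (ha : 0 < a) {b : ℂ} (hb : 0 ≤ b.re) (f : ℂ → ℂ) :
    hardySq (compFun (fun w => a * w + b) f) ≤ ENNReal.ofReal a⁻¹ * hardySq f := by
  refine iSup₂_le fun x hx => ?_
  change ENNReal.ofReal (1 / Real.pi) * sl (compFun (fun w => a * w + b) f) x ≤ _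
  rw [sl_comp_affine ha hx, mul_left_comm]
  gcongr
  have : 0 < a * x + b.re := by positivity
  exact le_iSup₂_of_le (a * x + b.re) this le_rfl

lemma memHardy_comp_affine {a : ℝ} (ha : 0 < a) {b : ℂ} (hb : 0 ≤ b.re) {f : ℂ → ℂ}
    (hf : MemHardy f) : MemHardy (compFun (fun w => a * w + b) f) where
  diff := by
    have h : DifferentiableOn ℂ (f ∘ fun w => a * w + b) rightHalfPlane :=
      hf.diff.comp (by fun_prop) fun w hw => affine_mem ha hb hw
    exact h.congr fun w hw => indicator_of_mem hw _
  zero_of_notMem w hw := indicator_of_notMem hw _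
  finite := (hardySq_comp_affine_le ha hb f).trans_lt
    (ENNReal.mul_lt_top ENNReal.ofReal_lt_top hf.finite)

end HardyAux

namespace HardyH2

/-- The composition operator `C_φ f = f ∘ φ` on the Hardy space, for `φ(w) = a w + b` with
`a > 0` and `Re b ≥ 0`. -/
noncomputable def compAffine (a : ℝ) (b : ℂ) (ha : 0 < a) (hb : 0 ≤ b.re) :
    HardyH2 →L[ℂ] HardyH2 :=
  LinearMap.mkContinuous
    { toFun := fun f => mk (HardyAux.compFun (fun w => a * w + b) f)
        (HardyAux.memHardy_comp_affine ha hb f.mem)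
      map_add' := fun f g => ext fun w hw => by
        simp [HardyAux.compFun, indicator_of_mem hw]
      map_smul' := fun c f => ext fun w hw => by
        simp [HardyAux.compFun, indicator_of_mem hw] }
    (Real.sqrt a⁻¹) fun f => by
      have h := ENNReal.toReal_mono (ENNReal.mul_ne_top ENNReal.ofReal_ne_top f.mem.finite.ne)
        (HardyAux.hardySq_comp_affine_le ha hb f)
      rw [ENNReal.toReal_mul, ENNReal.toReal_ofReal (inv_nonneg.2 ha.le)] at h
      rw [norm_def f, ← Real.sqrt_mul (inv_nonneg.2 ha.le)]
      exact Real.sqrt_le_sqrt h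

lemma compAffine_apply {a : ℝ} {b : ℂ} (ha : 0 < a) (hb : 0 ≤ b.re) (f : HardyH2) {w : ℂ}
    (hw : w ∈ rightHalfPlane) : compAffine a b ha hb f w = f (a * w + b) :=
  indicator_of_mem hw _

/-- The composition operator `C_τ`, for `τ(w) = w + c` with `Re c = 0`, as an invertible operator;
its inverse is the composition operator of `w ↦ w - c`. -/
noncomputable def compTranslation (c : ℂ) (hc : c.re = 0) : HardyH2 ≃L[ℂ] HardyH2 :=
  ContinuousLinearEquiv.equivOfInverse
    (compAffine 1 c one_pos hc.ge) (compAffine 1 (-c) one_pos (by simp [hc]))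
    (fun f => ext fun w hw => by
      rw [compAffine_apply _ _ _ hw, compAffine_apply _ _ _
        (HardyAux.affine_mem one_pos (by simp [hc]) hw)]
      simp)
    (fun f => ext fun w hw => by
      rw [compAffine_apply _ _ _ hw, compAffine_apply _ _ _
        (HardyAux.affine_mem one_pos hc.ge hw)]
      simp)

lemma compTranslation_apply {c : ℂ} (hc : c.re = 0) (f : HardyH2) {w : ℂ}
    (hw : w ∈ rightHalfPlane) : compTranslation c hc f w = f (w + c) := by
  change compAffine 1 c one_pos hc.ge f w = _
  rw [compAffine_apply _ _ _ hw]
  simp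

end HardyH2

/-- A conjugation on a complex inner product space: a conjugate-linear involution `C` with
`⟨C x, C y⟩ = ⟨y, x⟩`. -/
structure IsConjugation {H : Type*} [NormedAddCommGroup H] [InnerProductSpace ℂ H]
    (C : H → H) : Prop where
  map_add : ∀ x y, C (x + y) = C x + C y
  map_smul : ∀ (c : ℂ) (x : H), C (c • x) = conj c • C x
  involutive : ∀ x, C (C x) = x
  inner_map : ∀ x y, inner ℂ (C x) (C y) = inner ℂ y x

/-- A bounded operator `T` is `C`-symmetric if `C` is a conjugation and `C T* C = T`. -/
def IsSymmetricFor {H : Type*} [NormedAddCommGroup H] [InnerProductSpace ℂ H] [CompleteSpace H]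
    (C : H → H) (T : H →L[ℂ] H) : Prop :=
  IsConjugation C ∧ ∀ x, C (ContinuousLinearMap.adjoint T (C x)) = T x

lemma pos_of_hyperbolic {a : ℝ} (ha : a ∈ Ioo (0 : ℝ) 1 ∪ Ioi 1) : 0 < a :=
  ha.elim (fun h => h.1) fun h => one_pos.trans h

lemma re_div_one_sub (a : ℝ) {b : ℂ} (hb : b.re = 0) : (b / (1 - a)).re = 0 := by
  rw [← Complex.ofReal_one, ← Complex.ofReal_sub, Complex.div_ofReal_re, hb, zero_div]

/-! The crux is that the inversion `W₀` acts on the Hardy space and reverses inner products.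
Everything is read off from the reproducing kernel `K`, without boundary values.

Point evaluations are bounded, so `K` exists. An affine map `w ↦ a w + b` with `Re b = 0` permutes
the vertical lines in the half-plane, so composition with it multiplies inner products by `a⁻¹`.
Hence the kernel is covariant: `K (a v + b) (a u + b) = a⁻¹ K v u` (`kernel_affine`). These maps act
transitively, so `K 1` determines `K`; holomorphy of `K 1` and `K u` with Hermitian symmetry forces
a first-order differential equation on `K 1`, whose solution gives `K v u = c / (u + conj v)`
(`exists_kernel_eq`).

From this formula the inversion of `K u` is `(1 / u) • K (1 / conj u)`, and pairing with kernels is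
evaluation, so the conjugation identity holds on kernels. It makes inversion isometric, hence
survives limits; kernels span a dense subspace, so inversion is defined everywhere
(`inversionDomain_eq_top`) and is a conjugation.

Translation by an imaginary number is unitary, so `W` is a conjugation as well. For symmetry, the
adjoint of `C_φ` is `a⁻¹ C_{φ⁻¹}`, and centring at the fixed point of `φ` turns `φ` into `z ↦ a z`,
which inversion exchanges with `z ↦ z / a`. -/

namespace HardyH2

/-! ### Reproducing kernel and its covariance under affine maps -/

lemma exists_reproducing_kernel :
    ∃ K : ℂ → HardyH2, ∀ u ∈ rightHalfPlane, ∀ f : HardyH2, inner ℂ (K u) f = f u := by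
  have h : ∀ u ∈ rightHalfPlane, ∃ k : HardyH2, ∀ f : HardyH2, inner ℂ k f = f u := by
    intro u hu
    have hu : 0 < u.re := hu
    let e : HardyH2 →L[ℂ] ℂ := LinearMap.mkContinuous
      { toFun := fun f => f u
        map_add' := fun _ _ => rfl
        map_smul' := fun _ _ => rfl }
      (Real.sqrt (2 / (u.re / 2))) fun f => norm_apply_le f (half_pos hu) (half_lt_self hu)
    exact ⟨(InnerProductSpace.toDual ℂ HardyH2).symm e, fun f => by
      rw [InnerProductSpace.toDual_symm_apply]; rfl⟩
  choose! K hK using h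
  exact ⟨K, hK⟩

/-- With `Re b = 0`, the line over `x` is the image of the line over `a⁻¹ x`. No line is missed, so
the general upper bound becomes an equality. -/
lemma norm_compAffine_sq {a : ℝ} {b : ℂ} (ha : 0 < a) (hb : b.re = 0) (f : HardyH2) :
    ‖compAffine a b ha hb.ge f‖ ^ 2 = a⁻¹ * ‖f‖ ^ 2 := by
  have h : hardySq (compAffine a b ha hb.ge f) = ENNReal.ofReal a⁻¹ * hardySq f := by
    refine le_antisymm (HardyAux.hardySq_comp_affine_le ha hb.ge f) ?_
    rw [HardyAux.hardySq_eq f, mul_left_comm, ENNReal.mul_iSup, HardyAux.hardySq_eq]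
    refine mul_le_mul' le_rfl (iSup_le fun x => ?_)
    have hx : 0 < a⁻¹ * x.1 := mul_pos (inv_pos.2 ha) x.2
    have hle := HardyAux.sl_comp_affine ha (b := b) (f := f) hx
    rw [hb, mul_inv_cancel_left₀ ha.ne', add_zero] at hle
    rw [← hle]
    exact le_iSup (fun y : Ioi (0 : ℝ) => HardyAux.sl (compAffine a b ha hb.ge f) y)
      ⟨a⁻¹ * x.1, hx⟩
  rw [norm_sq, norm_sq, h, ENNReal.toReal_mul, ENNReal.toReal_ofReal (inv_nonneg.2 ha.le)]

lemma inner_compAffine {a : ℝ} {b : ℂ} (ha : 0 < a) (hb : b.re = 0) (f g : HardyH2) :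
    inner ℂ (compAffine a b ha hb.ge f) (compAffine a b ha hb.ge g)
      = (a : ℂ)⁻¹ * inner ℂ f g := by
  have h := fun f => norm_compAffine_sq ha hb f
  have h' : ∀ f, ((‖compAffine a b ha hb.ge f‖ : ℂ)) ^ 2 = (a : ℂ)⁻¹ * (‖f‖ : ℂ) ^ 2 := by
    intro f
    exact_mod_cast congrArg (fun t : ℝ => (t : ℂ)) (h f)
  rw [inner_eq_sum_norm_sq_div_four, inner_eq_sum_norm_sq_div_four]
  simp only [← map_add, ← map_sub, ← map_smul, Complex.coe_algebraMap, h']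
  ring

lemma compAffine_compAffine_inv {a : ℝ} {b : ℂ} (ha : 0 < a) (hb : b.re = 0)
    (hinv : (-(b / a)).re = 0) (f : HardyH2) :
    compAffine a b ha hb.ge (compAffine a⁻¹ (-(b / a)) (inv_pos.2 ha) hinv.ge f) = f := by
  have ha' : (a : ℂ) ≠ 0 := by exact_mod_cast ha.ne'
  refine ext fun w hw => ?_
  rw [compAffine_apply _ _ _ hw, compAffine_apply _ _ _ (HardyAux.affine_mem ha hb.ge hw)]
  congr 1
  push_cast
  field_simp
  ring

/-- Composition with the map is `a^(-1/2)` times a unitary, and a kernel is determined by its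
pairings. -/
lemma kernel_affine {K : ℂ → HardyH2}
    (hK : ∀ u ∈ rightHalfPlane, ∀ f : HardyH2, inner ℂ (K u) f = f u)
    {a : ℝ} {b : ℂ} (ha : 0 < a) (hb : b.re = 0) {u v : ℂ} (hu : u ∈ rightHalfPlane)
    (hv : v ∈ rightHalfPlane) : K (a * v + b) (a * u + b) = (a : ℂ)⁻¹ * K v u := by
  have hinv : (-(b / a)).re = 0 := by simp [hb]
  have ha' : (a : ℂ) ≠ 0 := by exact_mod_cast ha.ne'
  have hv' := HardyAux.affine_mem ha hb.ge hv
  have e : K v = (a : ℂ) • compAffine a b ha hb.ge (K (a * v + b)) := by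
    refine ext_inner_right ℂ fun f => ?_
    rw [hK v hv, inner_smul_left]
    -- Writing `f` as a composite lets both sides of the inner product lose the composition operator
    -- at the price of `a⁻¹`.
    conv_rhs => rw [← compAffine_compAffine_inv ha hb hinv f]
    rw [inner_compAffine ha hb, hK _ hv', compAffine_apply _ _ _ hv', Complex.conj_ofReal,
      mul_inv_cancel_left₀ ha']
    congr 1
    push_cast
    field_simp
    ring
  rw [e, smul_apply, compAffine_apply _ _ _ hu, inv_mul_cancel_left₀ ha']

/-! ### Explicit form of the kernel -/

lemma kernel_conj_symm {K : ℂ → HardyH2}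
    (hK : ∀ u ∈ rightHalfPlane, ∀ f : HardyH2, inner ℂ (K u) f = f u)
    {u v : ℂ} (hu : u ∈ rightHalfPlane) (hv : v ∈ rightHalfPlane) :
    K u v = conj (K v u) := by
  rw [← hK v hv, ← hK u hu, inner_conj_symm]

lemma one_mem_rhp : (1 : ℂ) ∈ rightHalfPlane := by simp [rightHalfPlane]

/-- Invariance under affine maps and the Cauchy-Riemann equations in the second variable give a
differential equation for the kernel. -/
lemma kernel_one_deriv {K : ℂ → HardyH2}
    (hK : ∀ u ∈ rightHalfPlane, ∀ f : HardyH2, inner ℂ (K u) f = f u)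
    {u : ℂ} (hu : u ∈ rightHalfPlane) :
    K 1 u + (u + 1) * deriv (K 1) u = 0 := by
  have hg : HasDerivAt (K 1) (deriv (K 1) u) u :=
    ((K 1).mem.diff.differentiableAt (HardyAux.isOpen_rhp.mem_nhds hu)).hasDerivAt
  have hD : HasDerivAt (K u) (deriv (K u) 1) 1 :=
    ((K u).mem.diff.differentiableAt (HardyAux.isOpen_rhp.mem_nhds one_mem_rhp)).hasDerivAt
  -- The derivative of `K u` at `1` is computed in two directions. Vertically, translation
  -- invariance gives `K u (1 + q i) = conj (K 1 (u - q i))`.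
  have hvert : deriv (K u) 1 * Complex.I = conj (deriv (K 1) u * -Complex.I) := by
    have h1 : HasDerivAt (fun q : ℝ => K u (1 + q * Complex.I))
        (deriv (K u) 1 * Complex.I) 0 := by
      have : HasDerivAt (fun q : ℝ => 1 + (q : ℂ) * Complex.I) Complex.I 0 := by
        simpa using ((Complex.ofRealCLM.hasDerivAt (x := (0 : ℝ))).mul_const
          Complex.I).const_add 1
      exact HasDerivAt.comp (0 : ℝ) (h₂ := (K u : ℂ → ℂ)) (by simpa using hD) this
    have h2 : HasDerivAt (fun q : ℝ => conj (K 1 (u + q * -Complex.I)))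
        (conj (deriv (K 1) u * -Complex.I)) 0 := by
      have : HasDerivAt (fun q : ℝ => u + (q : ℂ) * -Complex.I) (-Complex.I) 0 := by
        simpa using ((Complex.ofRealCLM.hasDerivAt (x := (0 : ℝ))).mul_const
          (-Complex.I)).const_add u
      exact (HasDerivAt.comp (0 : ℝ) (h₂ := (K 1 : ℂ → ℂ)) (by simpa using hg) this).star
    refine h1.unique (h2.congr_of_eventuallyEq (Eventually.of_forall fun q => ?_))
    have hb : (-(q : ℂ) * Complex.I).re = 0 := by simp
    have hq : 1 + (q : ℂ) * Complex.I ∈ rightHalfPlane := by simp [rightHalfPlane]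
    have := kernel_affine hK one_pos hb hu hq
    simp only [Complex.ofReal_one, one_mul, inv_one, neg_mul, add_neg_cancel_right] at this
    change K u (1 + q * Complex.I) = conj (K 1 (u + q * -Complex.I))
    rw [kernel_conj_symm hK hu hq, ← this, mul_neg]
  -- Horizontally, dilation gives `K u p = conj (p⁻¹ K 1 (p⁻¹ u))`, valid for `p > 0`, hence near
  -- `1`.
  have hhor : deriv (K u) 1 = conj (-K 1 u - u * deriv (K 1) u) := by
    have h1 : HasDerivAt (fun p : ℝ => K u p) (deriv (K u) 1) 1 :=
      HasDerivAt.comp_ofReal (by simpa using hD)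
    have h2 : HasDerivAt (fun p : ℝ => conj ((p : ℂ)⁻¹ * K 1 ((p : ℂ)⁻¹ * u)))
        (conj (-K 1 u - u * deriv (K 1) u)) 1 := by
      have hi : HasDerivAt (fun p : ℂ => p⁻¹) (-1) ((1 : ℝ) : ℂ) := by
        simpa using hasDerivAt_inv (one_ne_zero (α := ℂ))
      have hc : HasDerivAt (fun p : ℂ => K 1 (p⁻¹ * u)) (deriv (K 1) u * (-1 * u))
          ((1 : ℝ) : ℂ) :=
        HasDerivAt.comp _ (h₂ := (K 1 : ℂ → ℂ)) (by simpa using hg) (hi.mul_const u)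
      refine ((hi.mul hc).comp_ofReal).star.congr_deriv ?_
      refine congrArg (starRingEnd ℂ) ?_
      simp
      ring
    refine h1.unique (h2.congr_of_eventuallyEq ?_)
    filter_upwards [lt_mem_nhds (one_pos : (0 : ℝ) < 1)] with p hp
    have hp' : (p : ℂ) ≠ 0 := by exact_mod_cast hp.ne'
    have hpm : (p : ℂ) ∈ rightHalfPlane := by simpa [rightHalfPlane] using hp
    have := kernel_affine hK (inv_pos.2 hp) Complex.zero_re hu hpm
    simp only [Complex.ofReal_inv, add_zero, inv_mul_cancel₀ hp', inv_inv] at this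
    rw [kernel_conj_symm hK hu hpm, this, inv_mul_cancel_left₀ hp']
  rw [hhor, map_mul, map_neg, Complex.conj_I, neg_neg] at hvert
  have := (starRingEnd ℂ).injective (mul_right_cancel₀ Complex.I_ne_zero hvert)
  linear_combination -this

/-- The reproducing kernel is a multiple of `1 / (u + conj v)`. -/
lemma exists_kernel_eq {K : ℂ → HardyH2}
    (hK : ∀ u ∈ rightHalfPlane, ∀ f : HardyH2, inner ℂ (K u) f = f u) :
    ∃ c : ℝ, ∀ u ∈ rightHalfPlane, ∀ v ∈ rightHalfPlane, K v u = c / (u + conj v) := by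
  have hne : ∀ {z : ℂ}, z ∈ rightHalfPlane → z ≠ 0 := by
    rintro _ h rfl
    simp [rightHalfPlane] at h
  have hadd : ∀ {u v : ℂ}, u ∈ rightHalfPlane → v ∈ rightHalfPlane → u + v ∈ rightHalfPlane :=
    fun {u v} (hu : 0 < u.re) (hv : 0 < v.re) => show 0 < (u + v).re from add_pos hu hv
  -- The differential equation says exactly that `(u + 1) * K 1 u` has derivative zero.
  have hder : ∀ u ∈ rightHalfPlane,
      HasDerivAt (fun u => (u + 1) * K 1 u) 0 u := by
    intro u hu
    have hg : HasDerivAt (K 1) (deriv (K 1) u) u :=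
      ((K 1).mem.diff.differentiableAt (HardyAux.isOpen_rhp.mem_nhds hu)).hasDerivAt
    refine (((hasDerivAt_id u).add_const (1 : ℂ)).mul hg).congr_deriv ?_
    rw [one_mul]
    exact kernel_one_deriv hK hu
  have hconst : ∀ u ∈ rightHalfPlane, (u + 1) * K 1 u = (1 + 1) * K 1 1 := by
    intro u hu
    have hconv : Convex ℝ rightHalfPlane := convex_halfSpace_re_gt 0
    exact HardyAux.isOpen_rhp.is_const_of_deriv_eq_zero hconv.isPreconnected
      (fun z hz => (hder z hz).differentiableAt.differentiableWithinAt)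
      (fun z hz => (hder z hz).deriv) hu one_mem_rhp
  have hreal : conj (K 1 1) = K 1 1 := (kernel_conj_symm hK one_mem_rhp one_mem_rhp).symm
  obtain ⟨r, hr⟩ := Complex.conj_eq_iff_real.1 hreal
  -- Here `r = K 1 1`, and `2 * r` is the constant value of `(u + 1) * K 1 u`, read off at `u = 1`.
  refine ⟨2 * r, fun u hu v hv => ?_⟩
  have hv' : 0 < v.re := hv
  have hvne : (v.re : ℂ) ≠ 0 := by exact_mod_cast hv'.ne'
  have hb : (v.im * Complex.I : ℂ).re = 0 := by simp
  -- The map `w ↦ (Re v) w + i Im v` sends `1` to `v` and this point to `u`, which reduces `K v` to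
  -- `K 1`.
  have hz : ((v.re⁻¹ : ℝ) : ℂ) * (u - v.im * Complex.I) ∈ rightHalfPlane := by
    have hu : 0 < u.re := hu
    change 0 < (((v.re⁻¹ : ℝ) : ℂ) * (u - v.im * Complex.I)).re
    rw [Complex.re_ofReal_mul]
    simp
    positivity
  have h1 := kernel_affine hK hv' hb hz one_mem_rhp
  have h2 := hconst _ hz
  have hconj : (starRingEnd ℂ) v = v.re - v.im * Complex.I := by
    apply Complex.ext <;> simp
  have hcv : (starRingEnd ℂ) v ∈ rightHalfPlane := by simpa [rightHalfPlane] using hv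
  rw [mul_one, Complex.re_add_im, Complex.ofReal_inv, mul_inv_cancel_left₀ hvne,
    sub_add_cancel] at h1
  rw [h1, eq_div_iff (hne (hadd hu hcv)), hconj]
  rw [hr, Complex.ofReal_inv] at h2
  push_cast
  calc _ = ((v.re : ℂ)⁻¹ * (u - v.im * Complex.I) + (v.re : ℂ)⁻¹ * v.re) *
        K 1 ((v.re : ℂ)⁻¹ * (u - v.im * Complex.I)) := by ring
    _ = _ := by rw [inv_mul_cancel₀ hvne, h2]; ring

/-! ### Inversion on the whole Hardy space -/

lemma inv_conj_mem {w : ℂ} (hw : w ∈ rightHalfPlane) : 1 / conj w ∈ rightHalfPlane := by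
  have h : 0 < w.re := hw
  have hne : w ≠ 0 := by
    rintro rfl
    simp at h
  change 0 < (1 / conj w).re
  rw [one_div, Complex.inv_re, Complex.conj_re, Complex.normSq_conj]
  exact div_pos h (Complex.normSq_pos.2 hne)

/-- `F` is the image of `f` under `f ↦ (w ↦ conj (f (1 / conj w)) / w)`. -/
def IsInversion (f F : HardyH2) : Prop :=
  ∀ w ∈ rightHalfPlane, F w = 1 / w * conj (f (1 / conj w))

lemma IsInversion.symm {f F : HardyH2} (h : IsInversion f F) : IsInversion F f := by
  intro w hw
  have hne : w ≠ 0 := by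
    rintro rfl
    simp [rightHalfPlane] at hw
  rw [h _ (inv_conj_mem hw)]
  simp [hne]

lemma tendsto_apply {u : ℕ → HardyH2} {f : HardyH2} (h : Tendsto u atTop (𝓝 f)) {w : ℂ}
    (hw : w ∈ rightHalfPlane) : Tendsto (fun n => u n w) atTop (𝓝 (f w)) := by
  obtain ⟨K, hK⟩ := exists_reproducing_kernel
  simp only [← hK w hw]
  exact tendsto_const_nhds.inner h

/-- The vectors with an inversion in the Hardy space that satisfies the adjunction relation of a
conjugation. -/
def inversionDomain : Submodule ℂ HardyH2 where
  carrier := {g | ∃ g', IsInversion g g' ∧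
    ∀ f F, IsInversion f F → inner ℂ g F = inner ℂ f g'}
  zero_mem' := ⟨0, fun w _ => by
    rw [show ((0 : HardyH2) : ℂ → ℂ) = 0 from rfl]; simp, fun f F _ => by simp⟩
  add_mem' := by
    rintro g h ⟨g', hg, hgi⟩ ⟨h', hh, hhi⟩
    refine ⟨g' + h', fun w hw => ?_, fun f F hf => ?_⟩
    · rw [add_apply, add_apply, hg w hw, hh w hw, map_add, mul_add]
    · rw [inner_add_left, inner_add_right, hgi f F hf, hhi f F hf]
  smul_mem' := by
    rintro c g ⟨g', hg, hgi⟩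
    refine ⟨conj c • g', fun w hw => ?_, fun f F hf => ?_⟩
    · rw [smul_apply, smul_apply, hg w hw, map_mul]
      ring
    · rw [inner_smul_left, inner_smul_right, hgi f F hf]

/-- The adjunction relation makes inversion isometric on the domain, so the inversions of a
convergent sequence converge; both defining conditions pass to the limit. -/
lemma isClosed_inversionDomain : IsClosed (inversionDomain : Set HardyH2) := by
  refine IsSeqClosed.isClosed fun u f hu hf => ?_
  choose U hU hUi using hu
  have hdist : ∀ m n, dist (U m) (U n) = dist (u m) (u n) := by
    intro m n
    have hinv : IsInversion (u m - u n) (U m - U n) := fun w hw => by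
      rw [sub_apply, sub_apply, hU m w hw, hU n w hw, map_sub, mul_sub]
    have h1 : inner ℂ (u m - u n) (u m - u n) = inner ℂ (U m - U n) (U m - U n) := by
      -- The relation for `u m` and `u n` is tested on the pair `U m - U n`, `u m - u n`.
      rw [inner_sub_left, inner_sub_right (𝕜 := ℂ) (U m - U n), hUi m _ _ hinv.symm,
        hUi n _ _ hinv.symm]
    rw [inner_self_eq_norm_sq_to_K, inner_self_eq_norm_sq_to_K] at h1
    have h2 : ‖u m - u n‖ ^ 2 = ‖U m - U n‖ ^ 2 := by exact_mod_cast h1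
    rw [dist_eq_norm, dist_eq_norm]
    exact (pow_left_inj₀ (norm_nonneg _) (norm_nonneg _) two_ne_zero).1 h2.symm
  have hc : CauchySeq U := by
    have := hf.cauchySeq
    rw [Metric.cauchySeq_iff] at this ⊢
    simpa only [hdist] using this
  obtain ⟨F, hF⟩ := cauchySeq_tendsto_of_complete hc
  refine ⟨F, fun w hw => ?_, fun g G hg => ?_⟩
  · refine tendsto_nhds_unique (tendsto_apply hF hw) ?_
    simp only [hU _ w hw]
    exact ((Complex.continuous_conj.tendsto _).comp
      (tendsto_apply hf (inv_conj_mem hw))).const_mul _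
  · refine tendsto_nhds_unique (hf.inner tendsto_const_nhds) ?_
    simp only [hUi _ _ _ hg]
    exact tendsto_const_nhds.inner hF

lemma inversionDomain_eq_top : inversionDomain = ⊤ := by
  obtain ⟨K, hK⟩ := exists_reproducing_kernel
  obtain ⟨c, hc⟩ := exists_kernel_eq hK
  have hmem : ∀ u ∈ rightHalfPlane, K u ∈ inversionDomain := by
    intro u hu
    have hne : ∀ {z : ℂ}, z ∈ rightHalfPlane → z ≠ 0 := by
      rintro _ h rfl
      simp [rightHalfPlane] at h
    have hu0 := hne hu
    -- Both candidates equal `c / (1 + u w)` at `w`; the value of `c` plays no role.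
    refine ⟨(1 / u) • K (1 / conj u), fun w hw => ?_, fun f F hf => ?_⟩
    · have hw0 := hne hw
      rw [smul_apply, hc w hw _ (inv_conj_mem hu), hc _ (inv_conj_mem hw) u hu]
      simp only [map_div₀, map_add, map_one, Complex.conj_conj, Complex.conj_ofReal]
      rw [div_mul_div_comm, div_mul_div_comm]
      congr 1
      field_simp
      ring
    · rw [hK u hu, hf u hu, inner_smul_right, ← inner_conj_symm f, hK _ (inv_conj_mem hu)]
  -- A function orthogonal to all kernels vanishes at every point, so the closed domain is
  -- everything.
  rw [← isClosed_inversionDomain.submodule_topologicalClosure_eq,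
    Submodule.topologicalClosure_eq_top_iff, Submodule.eq_bot_iff]
  intro f hf
  refine ext fun w hw => ?_
  rw [← hK w hw, Submodule.inner_right_of_mem_orthogonal (hmem w hw) hf]
  rfl

lemma exists_inversion (g : HardyH2) : ∃ g', IsInversion g g' ∧
    ∀ f F, IsInversion f F → inner ℂ g F = inner ℂ f g' := by
  have h : g ∈ inversionDomain := inversionDomain_eq_top ▸ Submodule.mem_top
  exact h

lemma IsInversion.eq {f F G : HardyH2} (hF : IsInversion f F) (hG : IsInversion f G) : F = G :=
  ext fun w hw => (hF w hw).trans (hG w hw).symm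

lemma isConjugation_of_isInversion {J : HardyH2 → HardyH2} (hJ : ∀ f, IsInversion f (J f)) :
    IsConjugation J where
  map_add f g := (hJ (f + g)).eq fun w hw => by
    rw [add_apply, add_apply, hJ f w hw, hJ g w hw, map_add, mul_add]
  map_smul c f := (hJ (c • f)).eq fun w hw => by
    rw [smul_apply, smul_apply, hJ f w hw, map_mul]
    ring
  involutive f := (hJ (J f)).eq (hJ f).symm
  inner_map f g := by
    obtain ⟨g', hg, hgi⟩ := exists_inversion g
    rw [(hJ g).eq hg]
    -- By involutivity `f` is the inversion of `J f`, so the relation applies to the pair `J f`,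
    -- `f`.
    exact (hgi _ _ (hJ f).symm).symm

/-! ### Unitary translations and the adjoint of the composition operator -/

lemma compTranslation_symm_apply {c : ℂ} (hc : c.re = 0) (f : HardyH2) {w : ℂ}
    (hw : w ∈ rightHalfPlane) : (compTranslation c hc).symm f w = f (w - c) := by
  change compAffine 1 (-c) one_pos (by simp [hc]) f w = _
  rw [compAffine_apply _ _ _ hw]
  simp [sub_eq_add_neg]

lemma inner_compTranslation {c : ℂ} (hc : c.re = 0) (f g : HardyH2) :
    inner ℂ (compTranslation c hc f) (compTranslation c hc g) = inner ℂ f g := by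
  have h := inner_compAffine one_pos hc f g
  rw [Complex.ofReal_one, inv_one, one_mul] at h
  exact h

lemma inner_compTranslation_symm {c : ℂ} (hc : c.re = 0) (f g : HardyH2) :
    inner ℂ ((compTranslation c hc).symm f) ((compTranslation c hc).symm g) = inner ℂ f g := by
  rw [← inner_compTranslation hc]
  simp

/-- An invertible operator that scales inner products by `a⁻¹` has adjoint `a⁻¹` times its inverse.
-/
lemma adjoint_compAffine_apply {a : ℝ} {b : ℂ} (ha : 0 < a) (hb : b.re = 0) (f : HardyH2) {w : ℂ}
    (hw : w ∈ rightHalfPlane) :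
    ContinuousLinearMap.adjoint (compAffine a b ha hb.ge) f w = (a : ℂ)⁻¹ * f ((w - b) / a) := by
  have ha' : (a : ℂ) ≠ 0 := by exact_mod_cast ha.ne'
  have hinv : (-(b / a)).re = 0 := by simp [hb]
  have e : ContinuousLinearMap.adjoint (compAffine a b ha hb.ge) f =
      (a : ℂ)⁻¹ • compAffine a⁻¹ (-(b / a)) (inv_pos.2 ha) hinv.ge f := by
    refine ext_inner_right ℂ fun g => ?_
    rw [ContinuousLinearMap.adjoint_inner_left, inner_smul_left]
    conv_lhs => rw [← compAffine_compAffine_inv ha hb hinv f]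
    rw [inner_compAffine ha hb, map_inv₀, Complex.conj_ofReal]
  rw [e, smul_apply, compAffine_apply _ _ _ hw]
  congr 2
  push_cast
  field_simp
  ring

end HardyH2

/-! ### Conjugation and symmetry, centred at the fixed point -/

theorem corollary4p4 (a : ℝ) (ha : a ∈ Set.Ioo (0 : ℝ) 1 ∪ Set.Ioi 1) (b : ℂ) (hb : b.re = 0) :
    ∃ W₀ : HardyH2 → HardyH2,
      (∀ (f : HardyH2), ∀ w ∈ rightHalfPlane,
        W₀ f w = 1 / w * (starRingEnd ℂ) (f (1 / (starRingEnd ℂ) w))) ∧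
      let Cφ : HardyH2 →L[ℂ] HardyH2 := HardyH2.compAffine a b (pos_of_hyperbolic ha) hb.ge
      let Cτ : HardyH2 ≃L[ℂ] HardyH2 :=
        HardyH2.compTranslation (b / (1 - a)) (re_div_one_sub a hb)
      let W : HardyH2 → HardyH2 := Cτ.symm ∘ W₀ ∘ Cτ
      IsConjugation W ∧ IsSymmetricFor W Cφ := by
  choose J hJ _ using HardyH2.exists_inversion
  have hC := HardyH2.isConjugation_of_isInversion hJ
  refine ⟨J, hJ, ?_⟩
  intro Cφ Cτ W
  have hpos := pos_of_hyperbolic ha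
  have hd : (b / (1 - a)).re = 0 := re_div_one_sub a hb
  have hW : IsConjugation W :=
    { map_add := fun f g => by simp [W, hC.map_add]
      map_smul := fun c f => by simp [W, hC.map_smul]
      involutive := fun f => by simp [W, hC.involutive]
      inner_map := fun f g => by
        change inner ℂ (Cτ.symm (J (Cτ f))) (Cτ.symm (J (Cτ g))) = _
        rw [HardyH2.inner_compTranslation_symm, hC.inner_map, HardyH2.inner_compTranslation] }
  refine ⟨hW, hW, fun f => HardyH2.ext fun w hw => ?_⟩
  have ha' : (a : ℂ) ≠ 0 := by exact_mod_cast hpos.ne'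
  have ha1 : (1 - a : ℂ) ≠ 0 := by
    have : a ≠ 1 := ha.elim (fun h => h.2.ne) fun h => (mem_Ioi.1 h).ne'
    rw [sub_ne_zero]
    exact_mod_cast this.symm
  set d : ℂ := b / (1 - a) with hd_def
  -- `d` is the fixed point of `φ`: with `w = z + d`, `φ` becomes `z ↦ a z` and `W` becomes plain
  -- inversion in `z`.
  have hbd : b = d - a * d := by
    rw [hd_def]
    field_simp
  have hWapp : ∀ (g : HardyH2) {z : ℂ}, z ∈ rightHalfPlane →
      W g (z + d) = 1 / z * conj (g (1 / conj z + d)) := by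
    intro g z hz
    have hzd : z + d ∈ rightHalfPlane := by
      change 0 < (z + d).re
      rw [Complex.add_re, hd, add_zero]
      exact hz
    change Cτ.symm (J (Cτ g)) (z + d) = _
    rw [HardyH2.compTranslation_symm_apply _ _ hzd, add_sub_cancel_right, hJ _ _ hz,
      HardyH2.compTranslation_apply _ _ (HardyH2.inv_conj_mem hz)]
  obtain ⟨z, rfl⟩ : ∃ z, w = z + d := ⟨w - d, by ring⟩
  have hz : z ∈ rightHalfPlane := by
    have h : 0 < (z + d).re := hw
    rw [Complex.add_re, hd, add_zero] at h
    exact h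
  have hz0 : z ≠ 0 := by
    rintro rfl
    simp [rightHalfPlane] at hz
  have hzc := HardyH2.inv_conj_mem hz
  have hzc' : 1 / conj z + d ∈ rightHalfPlane := by
    change 0 < (1 / conj z + d).re
    rw [Complex.add_re, hd, add_zero]
    exact hzc
  have hza : 1 / conj z / a ∈ rightHalfPlane := by
    change 0 < (1 / conj z / a).re
    rw [Complex.div_ofReal_re]
    exact div_pos hzc hpos
  have e1 : (1 / conj z + d - b) / a = 1 / conj z / a + d := by
    rw [hbd]
    field_simp
    ring
  rw [hWapp _ hz, HardyH2.adjoint_compAffine_apply hpos hb _ hzc', e1, hWapp _ hza,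
    HardyH2.compAffine_apply _ _ _ hw]
  simp only [map_mul, map_div₀, map_one, map_inv₀, Complex.conj_conj, Complex.conj_ofReal]
  -- Inverting, dividing by `a` and inverting again is multiplication by `a`; the two weights and
  -- the adjoint's `a⁻¹` cancel.
  have e2 : 1 / (1 / z / a) + d = a * (z + d) + b := by
    rw [hbd]
    field_simp
    ring
  rw [e2]
  field_simp
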